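/- A list of complex numbers is called \emph{realisable} if it is the spectrum (the list of eigenvalues, counted with algebraic multiplicity, in any order) of an entrywise nonnegative real square matrix. The \emph{Perron eigenvalue} of a realisable list is the entry equal to the largest modulus of the entries of the list. Let $m\ge 3$ and let the list $(\rho,\alpha+i\beta,\alpha-i\beta,\lambda_4,\ldots,\lambda_m)$ of complex numbers be realisable, where $\rho$ is its Perron eigenvalue, $\alpha$ is real and $\beta>0$. Assume that either $$\alpha<0\quad\text{and}\quad \rho\ge-\frac{\alpha^2+\beta^2}{\alpha},$$ or both $$\rho\ge\alpha+2\sqrt2\,\beta\quad\text{and}\quad\rho\ge-3\alpha .$$ Then $(\rho-\alpha)^2-8\beta^2\ge0$, so that $$\lambda_\pm:=\tfrac14\left(\rho+3\alpha\pm\sqrt{(\rho-\alpha)^2-8\beta^2}\right),$$ the roots of $g(x)=\beta^2+(x-\alpha)(2x-\alpha-\rho)$, are real. Moreover, for every real $s\ge0$ one has $s+\rho-\lambda_-\ne0$ and the list $$(\rho+s,\mu_+,\mu_-,\lambda_+,\lambda_4,\ldots,\lambda_m)$$ is realisable with Perron eigenvalue $\rho+s$, where $$\mu_\pm=\alpha-\frac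 s2\pm\frac12\sqrt{\frac{s(s-2\alpha)^2+(s^2-4s\alpha-4\beta^2)\rho+\bigl(4\beta^2+s(3s-4\alpha+4\rho)\bigr)\lambda_-}{s+\rho-\lambda_-}}$$ (the number under the root is real but may be negative; the square root is the principal complex one). -/

import Mathlib

open scoped Matrix

noncomputable section

namespace NIEP

/-- The real square matrix `A` is entrywise nonnegative and its spectrum (the complex eigenvalues,
counted with algebraic multiplicity) is the list `σ`, up to order. -/
def Realises {n : ℕ} (A : Matrix (Fin n) (Fin n) ℝ) (σ : List ℂ) : Prop :=
  (∀ i j, 0 ≤ A i j) ∧ (A.map (algebraMap ℝ ℂ)).charpoly.roots = (σ : Multiset ℂ)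

/-- A list of complex numbers is realisable if it is the spectrum of a nonnegative matrix. -/
def Realisable (σ : List ℂ) : Prop :=
  ∃ (n : ℕ) (A : Matrix (Fin n) (Fin n) ℝ), Realises A σ

/-- `ρ` is the Perron eigenvalue of (any nonnegative matrix realising) the list `σ`:
it is an entry of `σ`, equal to the largest modulus of the entries of `σ`. -/
def IsPerronEigenvalue (ρ : ℝ) (σ : List ℂ) : Prop :=
  (ρ : ℂ) ∈ σ ∧ ∀ z ∈ σ, ‖z‖ ≤ ρ

/-- `λ₊ = (ρ + 3α + √((ρ - α)² - 8β²)) / 4`. -/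
def lamPlus (ρ α β : ℝ) : ℝ :=
  1 / 4 * (ρ + 3 * α + Real.sqrt ((ρ - α) ^ 2 - 8 * β ^ 2))

/-- `λ₋ = (ρ + 3α - √((ρ - α)² - 8β²)) / 4`. -/
def lamMinus (ρ α β : ℝ) : ℝ :=
  1 / 4 * (ρ + 3 * α - Real.sqrt ((ρ - α) ^ 2 - 8 * β ^ 2))

/-- The real number, possibly negative, under the square root in the formula for `μ₊`, `μ₋`. -/
def muRadicand (ρ α β s : ℝ) : ℝ :=
  (s * (s - 2 * α) ^ 2 + (s ^ 2 - 4 * s * α - 4 * β ^ 2) * ρ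
      + (4 * β ^ 2 + s * (3 * s - 4 * α + 4 * ρ)) * lamMinus ρ α β)
    / (s + ρ - lamMinus ρ α β)

/-- `μ₊`; the square root is the principal complex one. -/
def muPlus (ρ α β s : ℝ) : ℂ :=
  (α : ℂ) - (s : ℂ) / 2 + 1 / 2 * (muRadicand ρ α β s : ℂ) ^ (1 / 2 : ℂ)

/-- `μ₋`; the square root is the principal complex one. -/
def muMinus (ρ α β s : ℝ) : ℂ :=
  (α : ℂ) - (s : ℂ) / 2 - 1 / 2 * (muRadicand ρ α β s : ℂ) ^ (1 / 2 : ℂ)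

end NIEP

end

/-! Border a realising matrix by one row and one column. It may be taken to be a nonnegative `B`
with all row sums `ρ`; let `a + ib` be an eigenvector for `α + iβ`, scaled so that its entry of
largest modulus, at `j`, is 1. The span of `1`, `a`, `b` is `B`-invariant, so bordering by the
column `c(1 + a)`, the row `eⱼᵀ` and the corner `d` changes the characteristic polynomial in a
computable way: the factor `p = (X - ρ)((X - α)² + β²)` is replaced by `(X - d)p - c g`. Since `|a
i| ≤ 1`, the bordered matrix is nonnegative once `c, d ≥ 0`. With `d = λ₊`, a root of `g`, the
factor `X - λ₊` splits off and leaves the cubic `p - 2c(X - λ₋)`. The scalar `c` is fixed by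
requiring the root `ρ + s`; the other two roots are then `μ₊`, `μ₋`. The alternative hypotheses give
real `λ±` and `λ₊ ≥ 0`. A positive eigenvector for `ρ + s` shows that it is the Perron eigenvalue.
-/

namespace NIEP

/-! ### Perron–Frobenius theory and reduction to constant row sums. -/

section Perron

variable {ι : Type*} [Fintype ι]

/-- A real matrix with positive entries has a positive eigenvector, with nonnegative eigenvalue
bounded by the sum of the entries. -/
theorem exists_pos_eigenvector [Nonempty ι] (A : Matrix ι ι ℝ) (hA : ∀ i j, 0 < A i j) :
    ∃ (x : ι → ℝ) (r : ℝ), (∀ i, 0 < x i) ∧ 0 ≤ r ∧ r ≤ ∑ i, ∑ j, A i j ∧ A *ᵥ x = r • x := by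
  set C : ℝ := ∑ i, ∑ j, A i j with hC
  have hC0 : 0 ≤ C := Finset.sum_nonneg fun i _ => Finset.sum_nonneg fun j _ => (hA i j).le
  have bound : ∀ x ∈ stdSimplex ℝ ι, ∀ r : ℝ, (∀ i, r * x i ≤ (A *ᵥ x) i) → r ≤ C := by
    intro x hx r h
    calc r = ∑ i, r * x i := by rw [← Finset.mul_sum, hx.2, mul_one]
      _ ≤ ∑ i, (A *ᵥ x) i := Finset.sum_le_sum fun i _ => h i
      _ ≤ C := by
        refine Finset.sum_le_sum fun i _ => Finset.sum_le_sum fun j _ => ?_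
        have hx1 : x j ≤ 1 := by
          rw [← hx.2]
          exact Finset.single_le_sum (fun k _ => hx.1 k) (Finset.mem_univ j)
        exact mul_le_of_le_one_right (hA i j).le hx1
  have mulPos : ∀ v : ι → ℝ, (∀ i, 0 ≤ v i) → v ≠ 0 → ∀ i, 0 < (A *ᵥ v) i := by
    intro v hv hne i
    obtain ⟨k, hk⟩ := Function.ne_iff.mp hne
    exact Finset.sum_pos' (fun j _ => mul_nonneg (hA i j).le (hv j))
      ⟨k, Finset.mem_univ k, mul_pos (hA i k) (lt_of_le_of_ne (hv k) (Ne.symm hk))⟩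
  have hcont : Continuous fun x : ι → ℝ => A *ᵥ x := by fun_prop
  -- Collatz–Wielandt: the eigenvalue is the largest `r` with `r x ≤ A x` for some `x` in the
  -- simplex.
  let K : Set ((ι → ℝ) × ℝ) :=
    (stdSimplex ℝ ι ×ˢ Set.Icc 0 C) ∩ {p | ∀ i, p.2 * p.1 i ≤ (A *ᵥ p.1) i}
  have hK : IsCompact K := by
    refine ((isCompact_stdSimplex ℝ ι).prod isCompact_Icc).inter_right ?_
    simp only [Set.ofPred_forall]
    refine isClosed_iInter fun i => isClosed_le (by fun_prop) ?_
    exact (continuous_apply i).comp (hcont.comp continuous_fst)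
  have hKne : K.Nonempty := by
    classical
    obtain ⟨i⟩ := ‹Nonempty ι›
    refine ⟨(Pi.single i 1, 0), ⟨single_mem_stdSimplex ℝ i, le_rfl, hC0⟩, fun k => ?_⟩
    simp only [zero_mul]
    exact Finset.sum_nonneg fun j _ => mul_nonneg (hA k j).le
      ((single_mem_stdSimplex ℝ i).1 j)
  obtain ⟨⟨x, r⟩, ⟨⟨hx, hr0, hrC⟩, hxr⟩, hmax⟩ := hK.exists_isMaxOn hKne continuous_snd.continuousOn
  simp only at hx hr0 hrC
  have hxne : x ≠ 0 := by
    rintro rfl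
    simpa using hx.2
  have hAx := mulPos x hx.1 hxne
  have heq : A *ᵥ x = r • x := by
    by_contra hne
    -- If `A x ≠ r x`, positivity of `A` makes `r y < A y` strict in every entry for `y = A x`, so
    -- `y` admits a larger `r`.
    set y := A *ᵥ x with hy
    have h1 : ∀ i, 0 < (A *ᵥ (y - r • x)) i :=
      mulPos _ (fun i => by simpa using hxr i) (sub_ne_zero.mpr hne)
    have h2 : ∀ i, r * y i < (A *ᵥ y) i := by
      intro i
      have := h1 i
      rw [Matrix.mulVec_sub, Matrix.mulVec_smul, ← hy] at this
      simpa using this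
    obtain ⟨k, -, hk⟩ := Finset.exists_min_image Finset.univ (fun i => (A *ᵥ y) i / y i)
      Finset.univ_nonempty
    set r' := (A *ᵥ y) k / y k with hr'
    have hrr' : r < r' := by rw [hr', lt_div_iff₀ (hAx k)]; exact h2 k
    have hS : 0 < ∑ i, y i := Finset.sum_pos (fun i _ => hAx i) Finset.univ_nonempty
    have hmem : (∑ i, y i)⁻¹ • y ∈ stdSimplex ℝ ι := by
      refine ⟨fun i => mul_nonneg (inv_nonneg.mpr hS.le) (hAx i).le, ?_⟩
      simp only [Pi.smul_apply, smul_eq_mul]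
      rw [← Finset.mul_sum, inv_mul_cancel₀ hS.ne']
    have hle : ∀ i, r' * ((∑ i, y i)⁻¹ • y) i ≤ (A *ᵥ ((∑ i, y i)⁻¹ • y)) i := by
      intro i
      rw [Matrix.mulVec_smul]
      simp only [Pi.smul_apply, smul_eq_mul]
      have := (le_div_iff₀ (hAx i)).mp (hk i (Finset.mem_univ i))
      calc r' * ((∑ i, y i)⁻¹ * y i) = (∑ i, y i)⁻¹ * (r' * y i) := by ring
        _ ≤ _ := mul_le_mul_of_nonneg_left this (inv_nonneg.mpr hS.le)
    have hin : ((∑ i, y i)⁻¹ • y, r') ∈ K :=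
      ⟨⟨hmem, hr0.trans hrr'.le, bound _ hmem r' hle⟩, hle⟩
    exact absurd (hmax hin) (not_le.mpr hrr')
  refine ⟨x, r, fun i => ?_, hr0, hrC, heq⟩
  have h : 0 < r * x i := by simpa [heq] using hAx i
  exact (pos_iff_pos_of_mul_pos h).mp (lt_of_le_of_ne hr0 (by rintro rfl; simp at h))

variable [DecidableEq ι]

theorem charpoly_diagonal_conj (A : Matrix ι ι ℝ) (x : ι → ℝ) (hx : ∀ i, x i ≠ 0) :
    (Matrix.of fun i j => (x i)⁻¹ * A i j * x j).charpoly = A.charpoly := by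
  have h : (Matrix.of fun i j => (x i)⁻¹ * A i j * x j)
      = Matrix.diagonal (fun i => (x i)⁻¹) * (A * Matrix.diagonal x) := by
    ext i j
    simp [Matrix.diagonal_mul, Matrix.mul_diagonal, mul_assoc]
  rw [h, Matrix.charpoly_mul_comm, mul_assoc, Matrix.diagonal_mul_diagonal]
  simp [hx]

theorem continuous_eval_charpoly (t : ℝ) :
    Continuous fun A : Matrix ι ι ℝ => A.charpoly.eval t := by
  simp only [Matrix.eval_charpoly]
  exact (continuous_const.sub continuous_id).matrix_det

/-- A nonnegative matrix has the characteristic polynomial of a nonnegative matrix with constant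
row sums. -/
theorem exists_const_row_sum [Nonempty ι] (A : Matrix ι ι ℝ) (hA : ∀ i j, 0 ≤ A i j) :
    ∃ (B : Matrix ι ι ℝ) (r : ℝ), (∀ i j, 0 ≤ B i j) ∧ B.charpoly = A.charpoly ∧
      ∀ i, ∑ j, B i j = r := by
  -- `A` itself may have no positive eigenvector. Positive perturbations do; conjugating by it gives
  -- constant row sums, which bound the entries and allow a convergent subsequence.
  let E : ℕ → Matrix ι ι ℝ := fun k => Matrix.of fun i j => A i j + 1 / ((k : ℝ) + 1)
  have hE : ∀ k i j, 0 < E k i j := fun k i j => add_pos_of_nonneg_of_pos (hA i j) (by positivity)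
  choose x r hx hr0 hrC hxr using fun k => exists_pos_eigenvector (E k) (hE k)
  let B : ℕ → Matrix ι ι ℝ := fun k => Matrix.of fun i j => (x k i)⁻¹ * E k i j * x k j
  set C : ℝ := ∑ i, ∑ j, (A i j + 1) with hC
  have hBrow : ∀ k i, ∑ j, B k i j = r k := by
    intro k i
    have h : ∑ j, E k i j * x k j = r k * x k i := congrFun (hxr k) i
    simp only [B, Matrix.of_apply, mul_assoc]
    rw [← Finset.mul_sum, h, mul_comm, mul_assoc, mul_inv_cancel₀ (hx k i).ne', mul_one]
  have hB0 : ∀ k i j, 0 ≤ B k i j := fun k i j =>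
    mul_nonneg (mul_nonneg (inv_nonneg.mpr (hx k i).le) (hE k i j).le) (hx k j).le
  have hrC' : ∀ k, r k ≤ C := fun k => (hrC k).trans <|
    Finset.sum_le_sum fun i _ => Finset.sum_le_sum fun j _ => by
      have : 1 / ((k : ℝ) + 1) ≤ 1 := by
        rw [div_le_one (by positivity)]
        linarith [(Nat.cast_nonneg k : (0 : ℝ) ≤ k)]
      simp only [E, Matrix.of_apply]
      linarith
  let S : Set (ι → ι → ℝ) := Set.univ.pi fun _ => Set.univ.pi fun _ => Set.Icc 0 C
  have hS : IsCompact S := isCompact_univ_pi fun _ => isCompact_univ_pi fun _ => isCompact_Icc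
  have hmem : ∀ k, (B k : ι → ι → ℝ) ∈ S := fun k i _ j _ =>
    ⟨hB0 k i j, ((Finset.single_le_sum (fun j _ => hB0 k i j) (Finset.mem_univ j)).trans
      (hBrow k i).le).trans (hrC' k)⟩
  obtain ⟨L, hL, φ, hφ, hlim⟩ := hS.tendsto_subseq hmem
  have hentry : ∀ i j, Filter.Tendsto (fun k => B (φ k) i j) Filter.atTop (nhds (L i j)) :=
    fun i j => (tendsto_pi_nhds.mp ((tendsto_pi_nhds.mp hlim) i)) j
  have hrow : ∀ i, Filter.Tendsto (fun k => r (φ k)) Filter.atTop (nhds (∑ j, L i j)) := by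
    intro i
    have := tendsto_finsetSum Finset.univ fun j _ => hentry i j
    simpa only [hBrow] using this
  have hElim : Filter.Tendsto (fun k => E (φ k)) Filter.atTop (nhds A) := by
    refine Filter.Tendsto.comp (g := E) ?_ hφ.tendsto_atTop
    refine tendsto_pi_nhds.mpr fun i => tendsto_pi_nhds.mpr fun j => ?_
    simpa [E] using tendsto_one_div_add_atTop_nhds_zero_nat.const_add (A i j)
  obtain ⟨i₀⟩ := ‹Nonempty ι›
  refine ⟨L, ∑ j, L i₀ j, fun i j => (hL i trivial j trivial).1, ?_,
    fun i => tendsto_nhds_unique (hrow i) (hrow i₀)⟩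
  refine Polynomial.funext fun t => ?_
  have h1 := ((continuous_eval_charpoly t).tendsto L).comp hlim
  have h2 := ((continuous_eval_charpoly t).tendsto A).comp hElim
  refine tendsto_nhds_unique h1 (h2.congr fun k => ?_)
  exact congrArg (Polynomial.eval t)
    (charpoly_diagonal_conj (E (φ k)) (x (φ k)) fun i => (hx _ i).ne').symm

theorem exists_eigenvector (M : Matrix ι ι ℂ) (μ : ℂ) (hμ : μ ∈ M.charpoly.roots) :
    ∃ z : ι → ℂ, z ≠ 0 ∧ M *ᵥ z = μ • z := by
  have h : M.charpoly.eval μ = 0 := (Polynomial.mem_roots'.mp hμ).2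
  rw [Matrix.eval_charpoly] at h
  obtain ⟨z, hz, hz'⟩ := Matrix.exists_mulVec_eq_zero_iff.mpr h
  refine ⟨z, hz, ?_⟩
  rw [Matrix.sub_mulVec, sub_eq_zero] at hz'
  rw [← hz']
  ext i
  simp [Matrix.mulVec_diagonal]

/-- The moduli of the eigenvalues of a nonnegative matrix with a positive eigenvector are bounded
by the corresponding eigenvalue. -/
theorem norm_le_of_pos_eigenvector (A : Matrix ι ι ℝ) (hA : ∀ i j, 0 ≤ A i j) (y : ι → ℝ)
    (hy : ∀ i, 0 < y i) (r : ℝ) (hr : A *ᵥ y = r • y) (μ : ℂ)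
    (hμ : μ ∈ (A.map (algebraMap ℝ ℂ)).charpoly.roots) : ‖μ‖ ≤ r := by
  obtain ⟨z, hz0, hz⟩ := exists_eigenvector _ μ hμ
  obtain ⟨k, hk⟩ := Function.ne_iff.mp hz0
  -- The index `j` attains the sup norm of `z` weighted by `1 / y`.
  obtain ⟨j, -, hj⟩ := Finset.exists_max_image Finset.univ (fun i => ‖z i‖ / y i) ⟨k, Finset.mem_univ k⟩
  have hzj : 0 < ‖z j‖ := by
    have h := (div_pos (norm_pos_iff.mpr hk) (hy k)).trans_le (hj k (Finset.mem_univ k))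
    simpa [hy j] using (div_pos_iff_of_pos_right (hy j)).mp h
  refine le_of_mul_le_mul_right ?_ hzj
  calc ‖μ‖ * ‖z j‖ = ‖∑ i, ((A j i : ℝ) : ℂ) * z i‖ := by
        rw [← norm_mul]
        exact congrArg _ (congrFun hz j).symm
    _ ≤ ∑ i, A j i * ‖z i‖ := (norm_sum_le _ _).trans (Finset.sum_le_sum fun i _ => by
        rw [norm_mul, Complex.norm_real, Real.norm_of_nonneg (hA j i)])
    _ ≤ ∑ i, A j i * y i * (‖z j‖ / y j) := Finset.sum_le_sum fun i _ => by
        rw [mul_assoc]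
        refine mul_le_mul_of_nonneg_left ?_ (hA j i)
        have := (div_le_iff₀ (hy i)).mp (hj i (Finset.mem_univ i))
        linarith
    _ = r * ‖z j‖ := by
        have h : ∑ i, A j i * y i = r * y j := congrFun hr j
        rw [← Finset.sum_mul, h]
        field_simp [(hy j).ne']

end Perron

open Polynomial

/-! ### The bordered matrix: characteristic polynomial and eigenvector. -/

section Bordered

variable {ι : Type*} [DecidableEq ι]

/-- The matrix `B` bordered by the column `c (1 + a)`, the row `eⱼᵀ` and the corner entry `d`. -/
def bordered (B : Matrix ι ι ℝ) (a : ι → ℝ) (j : ι) (c d : ℝ) :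
    Matrix (ι ⊕ Fin 1) (ι ⊕ Fin 1) ℝ :=
  Matrix.fromBlocks B (Matrix.of fun i _ => c * (1 + a i))
    (Matrix.of fun _ k => if k = j then 1 else 0) (Matrix.of fun _ _ => d)

theorem bordered_nonneg {B : Matrix ι ι ℝ} {a : ι → ℝ} {c d : ℝ} (j : ι)
    (hB : ∀ i k, 0 ≤ B i k) (ha : ∀ i, |a i| ≤ 1) (hc : 0 ≤ c) (hd : 0 ≤ d) :
    ∀ i k, 0 ≤ bordered B a j c d i k := by
  rintro (i | i) (k | k)
  · exact hB i k
  · exact mul_nonneg hc (by linarith [(abs_le.mp (ha i)).1])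
  · simp only [bordered, Matrix.fromBlocks_apply₂₁, Matrix.of_apply]
    split_ifs <;> norm_num
  · exact hd

variable [Fintype ι]

/-- Invariance of the span of `1`, `a`, `b` gives `p (X - B)⁻¹(1 + a)` explicitly, with no division.
-/
theorem charmatrix_mulVec_eq {B : Matrix ι ι ℝ} {a b : ι → ℝ} {ρ α β : ℝ}
    (hrow : ∀ i, ∑ k, B i k = ρ) (ha : ∀ i, ∑ k, B i k * a k = α * a i - β * b i)
    (hb : ∀ i, ∑ k, B i k * b k = β * a i + α * b i) (i : ι) :
    (B.charmatrix *ᵥ fun i => ((X - C α) ^ 2 + C β ^ 2)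
      + (X - C ρ) * ((X - C α) * C (a i) - C β * C (b i))) i =
      (1 + C (a i)) * ((X - C ρ) * ((X - C α) ^ 2 + C β ^ 2)) := by
  have h1 : ∑ k, C (B i k) = C ρ := by rw [← map_sum, hrow]
  have h2 : ∑ k, C (B i k) * C (a k) = C α * C (a i) - C β * C (b i) := by
    simp only [← C_mul, ← C_sub, ← map_sum, ha]
  have h3 : ∑ k, C (B i k) * C (b k) = C β * C (a i) + C α * C (b i) := by
    simp only [← C_mul, ← C_add, ← map_sum, hb]
  have h4 : ∑ k, C (B i k) * (((X - C α) ^ 2 + C β ^ 2)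
        + (X - C ρ) * ((X - C α) * C (a k) - C β * C (b k))) =
      ((X - C α) ^ 2 + C β ^ 2) * ∑ k, C (B i k)
        + (X - C ρ) * (X - C α) * ∑ k, C (B i k) * C (a k)
        - (X - C ρ) * C β * ∑ k, C (B i k) * C (b k) := by
    simp only [Finset.mul_sum, ← Finset.sum_add_distrib, ← Finset.sum_sub_distrib]
    exact Finset.sum_congr rfl fun k _ => by ring
  rw [Matrix.charmatrix, Matrix.sub_mulVec, Pi.sub_apply, Matrix.scalar_apply,
    Matrix.mulVec_diagonal]
  refine (congrArg (_ - ·) h4).trans ?_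
  rw [h1, h2, h3]
  ring

/-- A Schur complement without inverting `N`: right multiplication by the block triangular matrix
with last column `(w, p)` clears the upper right block. -/
theorem det_fromBlocks_mul_of_mulVec {R : Type*} [CommRing R] (N : Matrix ι ι R) (w v r : ι → R)
    (q p : R) (h : N *ᵥ w = p • v) :
    (Matrix.fromBlocks N (Matrix.of fun i (_ : Fin 1) => -v i) (Matrix.of fun (_ : Fin 1) k => r k)
      (Matrix.of fun _ _ => q)).det * p = N.det * (r ⬝ᵥ w + q * p) := by
  have hT : (Matrix.fromBlocks 1 (Matrix.of fun i (_ : Fin 1) => w i) 0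
      (Matrix.of fun (_ : Fin 1) _ => p) : Matrix (ι ⊕ Fin 1) (ι ⊕ Fin 1) R).det = p := by
    simp [Matrix.det_fromBlocks_zero₂₁]
  rw [← hT, ← Matrix.det_mul, Matrix.fromBlocks_multiply, hT]
  have h0 : N * (Matrix.of fun i (_ : Fin 1) => w i)
      + (Matrix.of fun i (_ : Fin 1) => -v i) * (Matrix.of fun (_ : Fin 1) (_ : Fin 1) => p) = 0 := by
    ext i k
    have hi : ∑ l, N i l * w l = p * v i := congrFun h i
    simp [Matrix.mul_apply, hi, mul_comm]
  rw [h0, mul_one, Matrix.mul_zero, add_zero, Matrix.det_fromBlocks_zero₁₂]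
  congr 1
  simp [Matrix.mul_apply, dotProduct]

/-- Because `a j = 1` and `b j = 0`, the entry at `j` of the vector in `charmatrix_mulVec_eq` is
exactly `g`. -/
theorem charpoly_bordered {B : Matrix ι ι ℝ} {a b : ι → ℝ} {ρ α β : ℝ} {j : ι} (c d : ℝ)
    (hrow : ∀ i, ∑ k, B i k = ρ) (ha : ∀ i, ∑ k, B i k * a k = α * a i - β * b i)
    (hb : ∀ i, ∑ k, B i k * b k = β * a i + α * b i) (haj : a j = 1) (hbj : b j = 0) :
    (bordered B a j c d).charpoly * ((X - C ρ) * ((X - C α) ^ 2 + C β ^ 2)) =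
      B.charpoly * ((X - C d) * ((X - C ρ) * ((X - C α) ^ 2 + C β ^ 2))
        - C c * (C β ^ 2 + (X - C α) * (2 * X - C α - C ρ))) := by
  have h := det_fromBlocks_mul_of_mulVec B.charmatrix
    (C c • fun i => ((X - C α) ^ 2 + C β ^ 2)
      + (X - C ρ) * ((X - C α) * C (a i) - C β * C (b i)))
    (fun i => C c * (1 + C (a i))) (fun k => if k = j then -1 else 0) (X - C d)
    ((X - C ρ) * ((X - C α) ^ 2 + C β ^ 2)) (by
      ext1 i
      rw [Matrix.mulVec_smul, Pi.smul_apply, charmatrix_mulVec_eq hrow ha hb, Pi.smul_apply,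
        smul_eq_mul, smul_eq_mul]
      ring)
  have hM : (bordered B a j c d).charmatrix = Matrix.fromBlocks B.charmatrix
      (Matrix.of fun i _ => -(C c * (1 + C (a i)))) (Matrix.of fun _ k => if k = j then -1 else 0)
      (Matrix.of fun _ _ => X - C d) := by
    rw [bordered, Matrix.charmatrix_fromBlocks]
    congr 1
    · ext1 i k
      simp
    · ext1 i k
      simp only [Matrix.neg_apply, Matrix.map_apply, Matrix.of_apply]
      split_ifs <;> simp
    · ext1 i k
      obtain rfl : i = k := Subsingleton.elim _ _
      simp [Matrix.charmatrix_apply_eq]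
  rw [Matrix.charpoly, Matrix.charpoly, hM, h]
  congr 1
  simp only [dotProduct, Pi.smul_apply, smul_eq_mul, ite_mul, zero_mul, Finset.sum_ite_eq',
    Finset.mem_univ, if_true, haj, hbj, C_1, C_0]
  ring

/-- The vector is that of `charmatrix_mulVec_eq` at `X = ρ + s`; `hc` and `hd` are the eigenvalue
equations of the upper block and the last row. -/
theorem bordered_mulVec {B : Matrix ι ι ℝ} {a b : ι → ℝ} {ρ α β : ℝ} {j : ι} {c d : ℝ}
    (hrow : ∀ i, ∑ k, B i k = ρ) (ha : ∀ i, ∑ k, B i k * a k = α * a i - β * b i)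
    (hb : ∀ i, ∑ k, B i k * b k = β * a i + α * b i) (haj : a j = 1) (hbj : b j = 0)
    {s e : ℝ} (hc : c * e = s * ((ρ + s - α) ^ 2 + β ^ 2))
    (hd : (ρ + s - α) ^ 2 + β ^ 2 + s * (ρ + s - α) = (ρ + s - d) * e) :
    bordered B a j c d *ᵥ Sum.elim
        (fun i => (ρ + s - α) ^ 2 + β ^ 2 + s * (a i * (ρ + s - α) - b i * β)) (fun _ => e) =
      (ρ + s) • Sum.elim
        (fun i => (ρ + s - α) ^ 2 + β ^ 2 + s * (a i * (ρ + s - α) - b i * β)) (fun _ => e) := by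
  ext (i | i)
  · have h : ∑ k, B i k * ((ρ + s - α) ^ 2 + β ^ 2 + s * (a k * (ρ + s - α) - b k * β)) =
        ((ρ + s - α) ^ 2 + β ^ 2) * ∑ k, B i k + s * (ρ + s - α) * ∑ k, B i k * a k
          - s * β * ∑ k, B i k * b k := by
      simp only [Finset.mul_sum, ← Finset.sum_add_distrib, ← Finset.sum_sub_distrib]
      exact Finset.sum_congr rfl fun k _ => by ring
    simp only [bordered, Matrix.mulVec, dotProduct, Fintype.sum_sum_type, Matrix.fromBlocks_apply₁₁,
      Matrix.fromBlocks_apply₁₂, Sum.elim_inl, Sum.elim_inr, h, hrow, ha, hb, Matrix.of_apply,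
      Finset.univ_unique, Finset.sum_singleton, Pi.smul_apply, smul_eq_mul]
    linear_combination (1 + a i) * hc
  · simp only [bordered, Matrix.mulVec, dotProduct, Fintype.sum_sum_type, Matrix.fromBlocks_apply₂₁,
      Matrix.fromBlocks_apply₂₂, Sum.elim_inl, Sum.elim_inr, Matrix.of_apply, ite_mul, one_mul,
      zero_mul, Finset.sum_ite_eq', Finset.mem_univ, if_true, haj, hbj,
      Finset.univ_unique, Finset.sum_singleton, Pi.smul_apply, smul_eq_mul]
    linear_combination hd

end Bordered

/-! ### From spectra to row sums and eigenvectors. -/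

theorem ofReal_mem_roots_of_eigenvector {ι : Type*} [Fintype ι] [DecidableEq ι] (B : Matrix ι ι ℝ)
    (v : ι → ℝ) (hv : v ≠ 0) (r : ℝ) (h : B *ᵥ v = r • v) :
    (r : ℂ) ∈ (B.map (algebraMap ℝ ℂ)).charpoly.roots := by
  have hr : B.charpoly.eval r = 0 := by
    rw [Matrix.eval_charpoly]
    refine Matrix.exists_mulVec_eq_zero_iff.mp ⟨v, hv, ?_⟩
    rw [Matrix.sub_mulVec, h, sub_eq_zero]
    ext i
    simp [Matrix.mulVec_diagonal]
  rw [mem_roots (Matrix.charpoly_monic _).ne_zero, IsRoot, Matrix.charpoly_map]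
  have := eval_map_algebraMap (B := ℂ) B.charpoly (r : ℂ)
  rw [this, ← Complex.coe_algebraMap, aeval_algebraMap_apply, aeval_def, eval₂_eq_eval_map]
  simp [hr]

theorem roots_charpoly_map_congr {ι : Type*} [Fintype ι] [DecidableEq ι] {A B : Matrix ι ι ℝ}
    (h : B.charpoly = A.charpoly) : (B.map (algebraMap ℝ ℂ)).charpoly.roots =
      (A.map (algebraMap ℝ ℂ)).charpoly.roots := by
  rw [Matrix.charpoly_map, Matrix.charpoly_map, h]

/-- A nonnegative matrix with Perron eigenvalue `ρ` has the spectrum of a nonnegative matrix with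
row sums `ρ`. -/
theorem exists_row_sum_eq {n : ℕ} {A : Matrix (Fin n) (Fin n) ℝ} {σ : List ℂ} {ρ : ℝ}
    (hA : Realises A σ) (hρ : IsPerronEigenvalue ρ σ) :
    ∃ B : Matrix (Fin n) (Fin n) ℝ, Realises B σ ∧ ∀ i, ∑ j, B i j = ρ := by
  have hmem : ∀ z, z ∈ (A.map (algebraMap ℝ ℂ)).charpoly.roots ↔ z ∈ σ := fun z => by
    rw [hA.2, Multiset.mem_coe]
  have hne : Nonempty (Fin n) := by
    obtain ⟨z, hz, -⟩ := exists_eigenvector _ _ ((hmem ρ).mpr hρ.1)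
    by_contra hn
    rw [not_nonempty_iff] at hn
    exact hz (Subsingleton.elim _ _)
  obtain ⟨B, r, hB0, hBA, hrow⟩ := exists_const_row_sum A hA.1
  have hroots := roots_charpoly_map_congr hBA
  have hone : B *ᵥ 1 = r • (1 : Fin n → ℝ) := by
    ext i
    simp [Matrix.mulVec, dotProduct, hrow]
  have h1 : r ≤ ρ := by
    have h := ofReal_mem_roots_of_eigenvector B 1 one_ne_zero r hone
    rw [hroots, hmem] at h
    have := hρ.2 _ h
    rw [Complex.norm_real] at this
    exact (le_abs_self r).trans this
  have h2 : ρ ≤ r := by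
    have h := norm_le_of_pos_eigenvector B hB0 1 (fun _ => one_pos) r hone ρ
      (by rw [hroots, hmem]; exact hρ.1)
    rw [Complex.norm_real] at h
    exact (le_abs_self ρ).trans h
  exact ⟨B, ⟨hB0, hroots.trans hA.2⟩, fun i => (hrow i).trans (le_antisymm h1 h2)⟩

/-- The real and imaginary parts of an eigenvector, scaled so that its largest entry is `1`. -/
theorem exists_normalised_eigenvector {ι : Type*} [Fintype ι] [DecidableEq ι] (B : Matrix ι ι ℝ)
    (α β : ℝ) (h : (α : ℂ) + Complex.I * β ∈ (B.map (algebraMap ℝ ℂ)).charpoly.roots) :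
    ∃ (a b : ι → ℝ) (j : ι), (∀ i, ∑ k, B i k * a k = α * a i - β * b i) ∧
      (∀ i, ∑ k, B i k * b k = β * a i + α * b i) ∧ a j = 1 ∧ b j = 0 ∧
      ∀ i, a i ^ 2 + b i ^ 2 ≤ 1 := by
  obtain ⟨z, hz0, hz⟩ := exists_eigenvector _ _ h
  obtain ⟨k, hk⟩ := Function.ne_iff.mp hz0
  obtain ⟨j, -, hj⟩ := Finset.exists_max_image Finset.univ (fun i => ‖z i‖) ⟨k, Finset.mem_univ k⟩
  have hzj : 0 < ‖z j‖ := (norm_pos_iff.mpr hk).trans_le (hj k (Finset.mem_univ k))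
  have hzj0 : z j ≠ 0 := norm_pos_iff.mp hzj
  have hw : ∀ i, ∑ k, (B i k : ℂ) * (z k / z j) = ((α : ℂ) + Complex.I * β) * (z i / z j) := by
    intro i
    have hi : ∑ k, (B i k : ℂ) * z k = ((α : ℂ) + Complex.I * β) * z i := congrFun hz i
    simp only [← mul_div_assoc, ← Finset.sum_div, hi]
  refine ⟨fun i => (z i / z j).re, fun i => (z i / z j).im, j, fun i => ?_, fun i => ?_, ?_, ?_,
    fun i => ?_⟩
  · have := congrArg Complex.re (hw i)
    rw [Complex.re_sum] at this
    simpa only [Complex.re_ofReal_mul, Complex.mul_re, Complex.add_re, Complex.add_im,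
      Complex.ofReal_re, Complex.ofReal_im, Complex.I_re, Complex.I_im, Complex.mul_im, zero_mul,
      one_mul, mul_zero, sub_zero, add_zero, zero_add] using this
  · have := congrArg Complex.im (hw i)
    rw [Complex.im_sum] at this
    simp only [Complex.mul_im, Complex.mul_re, Complex.add_re,
      Complex.add_im, Complex.ofReal_re, Complex.ofReal_im, Complex.I_re, Complex.I_im, zero_mul,
      one_mul, mul_zero, sub_zero, add_zero, zero_add] at this
    rw [this]
    ring
  · simp [hzj0]
  · simp [hzj0]
  · have h1 : ‖z i / z j‖ ≤ 1 := by
      rw [norm_div, div_le_one hzj]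
      exact hj i (Finset.mem_univ i)
    have h2 : (z i / z j).re ^ 2 + (z i / z j).im ^ 2 = ‖z i / z j‖ ^ 2 := by
      rw [Complex.sq_norm, Complex.normSq_apply]
      ring
    rw [h2]
    exact pow_le_one₀ (norm_nonneg _) h1

/-! ### The numbers `λ±`, `μ±` and the factorisation of the quartic. -/

section Scalars

variable {ρ α β s : ℝ}

theorem lamPlus_add_lamMinus : lamPlus ρ α β + lamMinus ρ α β = (ρ + 3 * α) / 2 := by
  rw [lamPlus, lamMinus]
  ring

theorem lamPlus_mul_lamMinus (h : 0 ≤ (ρ - α) ^ 2 - 8 * β ^ 2) :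
    lamPlus ρ α β * lamMinus ρ α β = (β ^ 2 + α * (α + ρ)) / 2 := by
  rw [lamPlus, lamMinus]
  linear_combination (-1 / 16) * Real.sq_sqrt h

theorem lamMinus_lt (hα : α < ρ) : lamMinus ρ α β < ρ := by
  have := Real.sqrt_nonneg ((ρ - α) ^ 2 - 8 * β ^ 2)
  rw [lamMinus]
  linarith

/-- In the first case `(ρ - α)(-α) ≥ 2α² + β²`, and `(2α² + β²)² ≥ 8α²β²` by AM–GM. -/
theorem discr_nonneg (hβ : 0 < β) (h : (α < 0 ∧ ρ ≥ -(α ^ 2 + β ^ 2) / α) ∨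
    (ρ ≥ α + 2 * Real.sqrt 2 * β ∧ ρ ≥ -3 * α)) : 0 ≤ (ρ - α) ^ 2 - 8 * β ^ 2 := by
  rcases h with ⟨hα, h⟩ | ⟨h, -⟩
  · rw [ge_iff_le, div_le_iff_of_neg hα] at h
    have h1 : 2 * α ^ 2 + β ^ 2 ≤ (ρ - α) * (-α) := by nlinarith
    have h2 : (2 * α ^ 2 + β ^ 2) ^ 2 ≤ ((ρ - α) * (-α)) ^ 2 := by gcongr
    have h3 : 0 ≤ α ^ 2 * ((ρ - α) ^ 2 - 8 * β ^ 2) := by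
      linarith [sq_nonneg (2 * α ^ 2 - β ^ 2)]
    exact nonneg_of_mul_nonneg_right h3 (sq_pos_of_neg hα)
  · have h2 : (2 * Real.sqrt 2 * β) ^ 2 ≤ (ρ - α) ^ 2 := by
      gcongr
      linarith
    have h3 : (2 * Real.sqrt 2 * β) ^ 2 = 8 * β ^ 2 := by
      rw [mul_pow, mul_pow, Real.sq_sqrt (by norm_num)]
      ring
    linarith

/-- In the first case the hypothesis says `α² + β² + αρ ≤ 0`, i.e. `λ₊λ₋ ≤ 0`; in the second `ρ + 3α
≥ 0`. -/
theorem lamPlus_nonneg (h : (α < 0 ∧ ρ ≥ -(α ^ 2 + β ^ 2) / α) ∨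
    (ρ ≥ α + 2 * Real.sqrt 2 * β ∧ ρ ≥ -3 * α)) : 0 ≤ lamPlus ρ α β := by
  rw [lamPlus]
  rcases h with ⟨hα, h⟩ | ⟨-, h⟩
  · rw [ge_iff_le, div_le_iff_of_neg hα] at h
    have := (abs_le.mp (Real.abs_le_sqrt (x := ρ + 3 * α) (y := (ρ - α) ^ 2 - 8 * β ^ 2)
      (by nlinarith))).1
    linarith
  · have := Real.sqrt_nonneg ((ρ - α) ^ 2 - 8 * β ^ 2)
    linarith

theorem X_sub_muPlus_mul_X_sub_muMinus :
    (X - C (muPlus ρ α β s)) * (X - C (muMinus ρ α β s)) =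
      X ^ 2 + C ((s - 2 * α : ℝ) : ℂ) * X
        + C ((((s - 2 * α) ^ 2 - muRadicand ρ α β s) / 4 : ℝ) : ℂ) := by
  have hsq : ((muRadicand ρ α β s : ℂ) ^ (1 / 2 : ℂ)) ^ 2 = (muRadicand ρ α β s : ℂ) := by
    rw [one_div]
    exact_mod_cast Complex.cpow_nat_inv_pow (muRadicand ρ α β s : ℂ) two_ne_zero
  have hadd : muPlus ρ α β s + muMinus ρ α β s = -((s - 2 * α : ℝ) : ℂ) := by
    rw [muPlus, muMinus]
    push_cast
    ring
  have hmul : muPlus ρ α β s * muMinus ρ α β s =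
      (((s - 2 * α) ^ 2 - muRadicand ρ α β s) / 4 : ℝ) := by
    rw [muPlus, muMinus]
    push_cast
    linear_combination (-1 / 4) * hsq
  rw [← hmul, ← neg_neg (((s - 2 * α : ℝ) : ℂ)), ← hadd]
  simp only [C_neg, C_add, C_mul]
  ring

theorem quartic_factorisation {c : ℝ} (h : 0 ≤ (ρ - α) ^ 2 - 8 * β ^ 2)
    (hD : ρ + s - lamMinus ρ α β ≠ 0)
    (hc : c * (2 * (ρ + s - lamMinus ρ α β)) = s * ((ρ + s - α) ^ 2 + β ^ 2)) :
    ((X - C (lamPlus ρ α β)) * ((X - C ρ) * ((X - C α) ^ 2 + C β ^ 2))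
        - C c * (C β ^ 2 + (X - C α) * (2 * X - C α - C ρ)) : ℝ[X]) =
      (X - C (lamPlus ρ α β)) * ((X - C (ρ + s)) * (X ^ 2 + C (s - 2 * α) * X
        + C (((s - 2 * α) ^ 2 - muRadicand ρ α β s) / 4))) := by
  have hsum := lamPlus_add_lamMinus (ρ := ρ) (α := α) (β := β)
  have hprod := lamPlus_mul_lamMinus h
  have hrad : muRadicand ρ α β s * (ρ + s - lamMinus ρ α β) =
      s * (s - 2 * α) ^ 2 + (s ^ 2 - 4 * s * α - 4 * β ^ 2) * ρ
        + (4 * β ^ 2 + s * (3 * s - 4 * α + 4 * ρ)) * lamMinus ρ α β := by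
    rw [muRadicand, add_comm s ρ]
    exact div_mul_cancel₀ _ hD
  set q := ((s - 2 * α) ^ 2 - muRadicand ρ α β s) / 4 with hq
  -- `h1` and `h2` compare the linear and constant coefficients of the cubic; `h2` follows from `h1`
  -- because `ρ + s` is a root.
  have h1 : α ^ 2 + β ^ 2 + 2 * α * ρ - 2 * c = q - (ρ + s) * (s - 2 * α) := by
    refine mul_right_cancel₀ hD ?_
    rw [hq]
    linear_combination (1 / 4) * hrad - hc
  have h2 : -ρ * (α ^ 2 + β ^ 2) + 2 * c * lamMinus ρ α β = -(ρ + s) * q := by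
    linear_combination (-(ρ + s)) * h1 - hc
  refine Polynomial.funext fun x => ?_
  simp only [eval_sub, eval_mul, eval_add, eval_pow, eval_X, eval_C, eval_ofNat]
  linear_combination (x - lamPlus ρ α β) * (x * h1 + h2) + 2 * c * hprod - 2 * c * x * hsum

end Scalars

/-- Cancelling the common roots in a relation between monic polynomials. -/
theorem roots_eq_of_mul_eq {P Q : ℂ[X]} (hP : P.Monic) (hQ : Q.Monic) {σ τ l : List ℂ}
    (hroots : Q.roots = ((τ ++ l : List ℂ) : Multiset ℂ))
    (h : P * (τ.map fun z => X - C z).prod = Q * (σ.map fun z => X - C z).prod) :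
    P.roots = ((σ ++ l : List ℂ) : Multiset ℂ) := by
  have hmon : ∀ κ : List ℂ, (κ.map fun z => X - C z).prod.Monic := fun κ => by
    simpa using monic_multisetProd_X_sub_C (κ : Multiset ℂ)
  have hr : ∀ κ : List ℂ, (κ.map fun z => X - C z).prod.roots = (κ : Multiset ℂ) := fun κ => by
    simpa using roots_multiset_prod_X_sub_C (κ : Multiset ℂ)
  have h' := congrArg roots h
  rw [roots_mul (hP.mul (hmon τ)).ne_zero, roots_mul (hQ.mul (hmon σ)).ne_zero, hr, hr, hroots,
    ← Multiset.coe_add] at h'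
  rw [← Multiset.coe_add]
  refine add_right_cancel (b := (τ : Multiset ℂ)) (h'.trans ?_)
  abel

end NIEP

/-! ### The main theorem. -/

theorem mainTheorem6 (ρ α β : ℝ) (l : List ℂ) (hβ : 0 < β)
    (hreal : NIEP.Realisable
      ((ρ : ℂ) :: ((α : ℂ) + Complex.I * (β : ℂ)) :: ((α : ℂ) - Complex.I * (β : ℂ)) :: l))
    (hperron : NIEP.IsPerronEigenvalue ρ
      ((ρ : ℂ) :: ((α : ℂ) + Complex.I * (β : ℂ)) :: ((α : ℂ) - Complex.I * (β : ℂ)) :: l))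
    (hineq : (α < 0 ∧ ρ ≥ -(α ^ 2 + β ^ 2) / α) ∨
      (ρ ≥ α + 2 * Real.sqrt 2 * β ∧ ρ ≥ -3 * α)) :
    -- the square root defining `λ₊`, `λ₋` is that of a nonnegative real number
    0 ≤ (ρ - α) ^ 2 - 8 * β ^ 2 ∧
    ∀ s : ℝ, 0 ≤ s →
      -- the denominator in the formula for `μ₊`, `μ₋` does not vanish
      s + ρ - NIEP.lamMinus ρ α β ≠ 0 ∧
      NIEP.Realisable
        (((ρ + s : ℝ) : ℂ) :: NIEP.muPlus ρ α β s :: NIEP.muMinus ρ α β s ::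
          (NIEP.lamPlus ρ α β : ℂ) :: l) ∧
      NIEP.IsPerronEigenvalue (ρ + s)
        (((ρ + s : ℝ) : ℂ) :: NIEP.muPlus ρ α β s :: NIEP.muMinus ρ α β s ::
          (NIEP.lamPlus ρ α β : ℂ) :: l) := by
  have hdiscr := NIEP.discr_nonneg hβ hineq
  refine ⟨hdiscr, fun s hs => ?_⟩
  have hα : α < ρ := by
    have h1 : ‖(α : ℂ) + Complex.I * β‖ ≤ ρ := hperron.2 _ (by simp)
    have h2 : ‖(α : ℂ) + Complex.I * β‖ ^ 2 = α ^ 2 + β ^ 2 := by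
      rw [Complex.sq_norm, Complex.normSq_apply]
      simp
      ring
    have h3 : ‖(α : ℂ) + Complex.I * β‖ ^ 2 ≤ ρ ^ 2 := by gcongr
    exact lt_of_pow_lt_pow_left₀ 2 ((norm_nonneg _).trans h1) (by nlinarith)
  have hD : 0 < ρ + s - NIEP.lamMinus ρ α β := by
    have := NIEP.lamMinus_lt (β := β) hα
    linarith
  have hd := NIEP.lamPlus_nonneg hineq
  obtain ⟨n, A, hA⟩ := hreal
  obtain ⟨B, hB, hrow⟩ := NIEP.exists_row_sum_eq hA hperron
  obtain ⟨a, b, j, ha, hb, haj, hbj, hab⟩ := NIEP.exists_normalised_eigenvector B α β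
    (by rw [hB.2]; simp)
  have hN : 0 < (ρ + s - α) ^ 2 + β ^ 2 := by positivity
  -- This `c` makes `ρ + s` a root of `p - 2c(X - λ₋)`.
  obtain ⟨c, hc0, hc⟩ : ∃ c : ℝ, 0 ≤ c ∧
      c * (2 * (ρ + s - NIEP.lamMinus ρ α β)) = s * ((ρ + s - α) ^ 2 + β ^ 2) :=
    ⟨s * ((ρ + s - α) ^ 2 + β ^ 2) / (2 * (ρ + s - NIEP.lamMinus ρ α β)), by positivity,
      div_mul_cancel₀ _ (by positivity)⟩
  set d := NIEP.lamPlus ρ α β with hd_def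
  have hM0 := NIEP.bordered_nonneg (a := a) j hB.1
    (fun i => abs_le_one_iff_mul_self_le_one.mpr (by nlinarith [hab i, sq_nonneg (b i)])) hc0 hd
  set M := NIEP.bordered B a j c d with hM
  have hchar := NIEP.charpoly_bordered c d hrow ha hb haj hbj
  rw [NIEP.quartic_factorisation hdiscr hD.ne' hc, ← hM] at hchar
  have hroots : (M.map (algebraMap ℝ ℂ)).charpoly.roots =
      (([((ρ + s : ℝ) : ℂ), NIEP.muPlus ρ α β s, NIEP.muMinus ρ α β s, (d : ℂ)] ++ l : List ℂ) :
        Multiset ℂ) := by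
    refine NIEP.roots_eq_of_mul_eq (τ := [(ρ : ℂ), α + Complex.I * β, α - Complex.I * β])
      (Matrix.charpoly_monic _) (Matrix.charpoly_monic _) hB.2 ?_
    have h := congrArg (Polynomial.map (algebraMap ℝ ℂ)) hchar
    simp only [Polynomial.map_mul, Polynomial.map_sub, Polynomial.map_add, Polynomial.map_pow,
      Polynomial.map_X, Polynomial.map_C, Complex.coe_algebraMap,
      ← NIEP.X_sub_muPlus_mul_X_sub_muMinus] at h
    have hI : (Polynomial.X - Polynomial.C ((α : ℂ) + Complex.I * β)) *
        (Polynomial.X - Polynomial.C ((α : ℂ) - Complex.I * β)) =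
        (Polynomial.X - Polynomial.C (α : ℂ)) ^ 2 + Polynomial.C (β : ℂ) ^ 2 := by
      have h1 : (Polynomial.C Complex.I : Polynomial ℂ) ^ 2 = -1 := by
        rw [← Polynomial.C_pow, Complex.I_sq, Polynomial.C_neg, Polynomial.C_1]
      simp only [Polynomial.C_add, Polynomial.C_sub, Polynomial.C_mul]
      linear_combination (-Polynomial.C (β : ℂ) ^ 2) * h1
    simp only [List.map_cons, List.map_nil, List.prod_cons, List.prod_nil, mul_one]
    rw [hI, Matrix.charpoly_map, Matrix.charpoly_map, h]
    ring
  refine ⟨by rw [add_comm s ρ]; exact hD.ne', ⟨n + 1, Matrix.reindex finSumFinEquiv finSumFinEquiv M,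
    fun i k => hM0 _ _, ?_⟩, by simp, fun z hz => ?_⟩
  · have h : (Matrix.reindex finSumFinEquiv finSumFinEquiv M).map (algebraMap ℝ ℂ) =
      Matrix.reindex finSumFinEquiv finSumFinEquiv (M.map (algebraMap ℝ ℂ)) := rfl
    rw [h, Matrix.charpoly_reindex, hroots]
    rfl
  · refine NIEP.norm_le_of_pos_eigenvector M hM0 _ ?_ (ρ + s)
      (NIEP.bordered_mulVec hrow ha hb haj hbj hc ?_) z ?_
    · rintro (i | i)
      · simp only [Sum.elim_inl]
        -- Cauchy–Schwarz with `a i ^ 2 + b i ^ 2 ≤ 1`; strictness below comes from `α < ρ`.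
        have h1 : (a i * (ρ + s - α) - b i * β) ^ 2 ≤ (ρ + s - α) ^ 2 + β ^ 2 := by
          nlinarith [sq_nonneg (a i * β + b i * (ρ + s - α)),
            mul_le_mul_of_nonneg_right (hab i) hN.le]
        have h2 : s ^ 2 < (ρ + s - α) ^ 2 + β ^ 2 := by nlinarith
        have h3 : (s * (a i * (ρ + s - α) - b i * β)) ^ 2 < ((ρ + s - α) ^ 2 + β ^ 2) ^ 2 := by
          rw [mul_pow, sq ((ρ + s - α) ^ 2 + β ^ 2)]
          exact (mul_le_mul_of_nonneg_left h1 (sq_nonneg s)).trans_lt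
            (mul_lt_mul_of_pos_right h2 hN)
        linarith [(abs_lt.mp (abs_lt_of_sq_lt_sq h3 hN.le)).1]
      · simp only [Sum.elim_inr]
        linarith
    -- This is `g(x) = 2(x - λ₊)(x - λ₋)` at `x = ρ + s`.
    · linear_combination (2 * (ρ + s)) * NIEP.lamPlus_add_lamMinus (ρ := ρ) (α := α) (β := β)
        - 2 * NIEP.lamPlus_mul_lamMinus hdiscr
    · rw [hroots]
      exact hz
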